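/- Let $f$ be a transcendental entire function, let $U_0$ be a wandering domain of $f$ (a connected component of the Fatou set with $f^m(U_0)\cap f^n(U_0)=\varnothing$ for $m\neq n$), and for $n\ge 0$ let $U_n$ be the Fatou component containing $f^n(U_0)$. Assume that the $U_n$ are simply connected and semi-contracting: for all $z,z'\in U_0$ such that $f^k(z)\neq f^k(z')$ for every $k\ge 0$, the hyperbolic distances $d_{U_n}(f^n(z),f^n(z'))$ converge, as $n\to\infty$, to some $c(z,z')>0$, and $d_{U_n}(f^n(z),f^n(z'))\neq c(z,z')$ for every $n$. Assume moreover that, for every $n\ge 0$, the map $f\colon U_n\to U_{n+1}$ has degree $2$ (every point of $U_{n+1}$ has exactly two preimages in $U_n$, counted with multiplicity). Then there is a nonempty open set $V_0\subset U_0$ on which every iterate $f^n$, $n\geq 0$, is injective. Moreover, if $U_0$ is escaping (the point at infinity is the only limit function of $(f^n)$ on $U_0$) or oscillating (infinity and some finite value are both limit functions of $(f^n)$ on $U_0$), then $V_0$ can be chosen such that, in addition, for $V=\bigcup_{n\ge 0}f^n(V_0)$ the set of all entire functions that are $H(V)$-universal for $C_f$ is comeagre in $H(\mathbb{C})$. Here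 $H(\mathbb{C})$ carries the topology of locally uniform convergence, and an entire function $g$ is called $H(V)$-universal for $C_f\colon g\mapsto g\circ f$ if every holomorphic function on $V$ is a locally uniform limit on $V$ of a sequence of functions from $\{g\circ f^n|_V : n\ge 0\}$. -/

import Mathlib

open Filter Topology

namespace WanderingUniversality

/-! ### Entire functions -/

/-- `f` is a transcendental entire function: entire and not a polynomial. -/
def IsTranscendentalEntire (f : ℂ → ℂ) : Prop :=
  Differentiable ℂ f ∧ ¬ ∃ p : Polynomial ℂ, ∀ z, f z = p.eval z

/-- The space `H(ℂ)` of entire functions. As a subspace of `C(ℂ, ℂ)` with the compact-open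
topology, it carries the topology of locally uniform convergence. -/
abbrev EntireFunction : Type := {g : C(ℂ, ℂ) // Differentiable ℂ (g : ℂ → ℂ)}

/-! ### Fatou set and Fatou components -/

/-- The sequence `F` tends to infinity, locally uniformly on the (open) set `U`. -/
def TendstoInftyLocallyUniformlyOn (F : ℕ → ℂ → ℂ) (U : Set ℂ) : Prop :=
  ∀ K : Set ℂ, K ⊆ U → IsCompact K → ∀ R : ℝ, ∀ᶠ n in atTop, ∀ z ∈ K, R < ‖F n z‖

/-- The iterates of `f` form a normal family on `W`: every sequence of iterates has a subsequence
converging locally uniformly on `W` to a holomorphic function or to infinity. -/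
def IteratesNormalOn (f : ℂ → ℂ) (W : Set ℂ) : Prop :=
  ∀ s : ℕ → ℕ, ∃ t : ℕ → ℕ, StrictMono t ∧
    ((∃ φ : ℂ → ℂ, DifferentiableOn ℂ φ W ∧
        TendstoLocallyUniformlyOn (fun k => f^[s (t k)]) φ atTop W) ∨
      TendstoInftyLocallyUniformlyOn (fun k => f^[s (t k)]) W)

/-- The Fatou set of `f`. -/
def fatouSet (f : ℂ → ℂ) : Set ℂ :=
  {z | ∃ W : Set ℂ, IsOpen W ∧ IsConnected W ∧ z ∈ W ∧ IteratesNormalOn f W}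

/-- A Fatou component: a connected component of the Fatou set. -/
def IsFatouComponent (f : ℂ → ℂ) (U : Set ℂ) : Prop :=
  ∃ z ∈ fatouSet f, U = connectedComponentIn (fatouSet f) z

/-! ### Wandering domains -/

/-- A wandering domain: a Fatou component whose forward images are pairwise disjoint. -/
def IsWanderingDomain (f : ℂ → ℂ) (U : Set ℂ) : Prop :=
  IsFatouComponent f U ∧ ∀ m n : ℕ, m ≠ n → Disjoint (f^[m] '' U) (f^[n] '' U)

/-- `U 0` is a wandering domain and `U n` is the Fatou component containing `f^n(U 0)`. -/
def IsWanderingSequence (f : ℂ → ℂ) (U : ℕ → Set ℂ) : Prop :=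
  IsWanderingDomain f (U 0) ∧
    ∀ n, IsFatouComponent f (U n) ∧ Set.MapsTo f^[n] (U 0) (U n)

/-- Infinity is a limit function of the iterates of `f` on `U`. -/
def InftyIsLimitFunction (f : ℂ → ℂ) (U : Set ℂ) : Prop :=
  ∃ s : ℕ → ℕ, StrictMono s ∧ TendstoInftyLocallyUniformlyOn (fun k => f^[s k]) U

/-- The finite-valued function `φ` is a limit function of the iterates of `f` on `U`. -/
def IsFiniteLimitFunction (f : ℂ → ℂ) (U : Set ℂ) (φ : ℂ → ℂ) : Prop :=
  ∃ s : ℕ → ℕ, StrictMono s ∧ TendstoLocallyUniformlyOn (fun k => f^[s k]) φ atTop U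

/-- Escaping: infinity is the only limit function. -/
def IsEscaping (f : ℂ → ℂ) (U : Set ℂ) : Prop :=
  InftyIsLimitFunction f U ∧ ∀ φ : ℂ → ℂ, ¬ IsFiniteLimitFunction f U φ

/-- Oscillating: infinity and some finite value are limit functions. -/
def IsOscillating (f : ℂ → ℂ) (U : Set ℂ) : Prop :=
  InftyIsLimitFunction f U ∧ ∃ a : ℂ, IsFiniteLimitFunction f U (fun _ => a)

/-- `f` maps `U` into `V` with degree `d`: every point of `V` has exactly `d` preimages in `U`,
counted with multiplicity. -/
def HasDegree (f : ℂ → ℂ) (U V : Set ℂ) (d : ℕ) : Prop :=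
  Set.MapsTo f U V ∧ ∀ w ∈ V, {z | z ∈ U ∧ f z = w}.Finite ∧
    ∑ᶠ z ∈ {z | z ∈ U ∧ f z = w}, analyticOrderNatAt (fun ζ => f ζ - w) z = d

/-! ### Hyperbolic distance and semi-contracting wandering domains -/

/-- The hyperbolic (Poincaré) distance of the unit disc, curvature `-1`. -/
noncomputable def discDist (a b : ℂ) : ℝ :=
  2 * Real.artanh ‖(a - b) / (1 - (starRingEnd ℂ) a * b)‖

/-- `φ` is a conformal map from the open unit disc onto `U`. -/
def IsConformalFromDisc (φ : ℂ → ℂ) (U : Set ℂ) : Prop :=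
  DifferentiableOn ℂ φ (Metric.ball 0 1) ∧ Set.BijOn φ (Metric.ball 0 1) U

/-- The hyperbolic distance of a simply connected domain `U ≠ ℂ`: the hyperbolic distance of the
unit disc, transported by a conformal map `φ` from the disc onto `U`. Conformal automorphisms of
the disc preserve its distance, so all elements of the set below are equal; the infimum just
selects their common value. -/
noncomputable def hyperbolicDist (U : Set ℂ) (z w : ℂ) : ℝ :=
  sInf {r | ∃ φ : ℂ → ℂ, IsConformalFromDisc φ U ∧
    ∃ a ∈ Metric.ball (0 : ℂ) 1, ∃ b ∈ Metric.ball (0 : ℂ) 1,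
      φ a = z ∧ φ b = w ∧ r = discDist a b}

/-- The simply connected wandering domains `U n` are (hyperbolically) semi-contracting: for all
points `z, z'` of `U 0` whose orbits never merge, the hyperbolic distances of `f^n(z)` and
`f^n(z')` in `U n` converge to some `c(z, z') > 0` without ever being equal to it. -/
def IsSemiContracting (f : ℂ → ℂ) (U : ℕ → Set ℂ) : Prop :=
  (∀ n, IsSimplyConnected (U n)) ∧
    ∃ c : ℂ → ℂ → ℝ, ∀ z ∈ U 0, ∀ z' ∈ U 0, (¬ ∃ k : ℕ, f^[k] z = f^[k] z') →
      Tendsto (fun n => hyperbolicDist (U n) (f^[n] z) (f^[n] z')) atTop (𝓝 (c z z')) ∧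
      0 < c z z' ∧
      ∀ n, hyperbolicDist (U n) (f^[n] z) (f^[n] z') ≠ c z z'

/-! ### Universality -/

/-- The entire function `g` is `H(V)`-universal for `C_f`: every function holomorphic on `V` lies
in the closure of `{g ∘ f^n |_V : n ∈ ℕ}` in `C(V)` with the topology of locally uniform
convergence. -/
def IsUniversalOn (f : ℂ → ℂ) (V : Set ℂ) (g : ℂ → ℂ) : Prop :=
  ∀ h : C(V, ℂ), (∃ H : ℂ → ℂ, DifferentiableOn ℂ H V ∧ ∀ z : V, h z = H z) →
    h ∈ closure {u : C(V, ℂ) | ∃ n : ℕ, ∀ z : V, u z = g (f^[n] z)}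

end WanderingUniversality

namespace WanderingUniversality

open Set Metric

/-! ### Univalent functions -/

/-! Injectivity. Take `z₀` in `U 0` critical for no iterate, and `w₀` whose orbit never merges with
that of `z₀`. Riemann maps sending `0` to `f^n(z₀)` turn `f : U n → U (n+1)` into disc self-maps `g
n` fixing `0`. If `|(g n)'(0)| < 1/2` held infinitely often, a refined Schwarz lemma would contract
the orbit of `w₀` by a fixed factor each time, and its distance to that of `z₀` would tend to `0`,
not to `c > 0` (`eventually_half_le_norm_deriv`). So eventually the derivative is at least `1/2`,
and `g n` is injective on a fixed disc, which it maps into itself. Pulling back by the first `N`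
iterates gives `V₀`, a ball.

Universality. By Baire it suffices to approximate a given entire function on a disc and,
simultaneously, a function on compact `K ⊆ V` after composition with some `f^n`. Finitely many sets
`f^(n+m)(closed disc)` cover `f^n(K)`. They are disjoint since `U 0` wanders, and far from the
origin for suitable `n`. Runge approximation on such unions (`exists_polynomial_approx`) combines a
Banach-algebra argument, giving resolvents as limits of polynomials, with a Cauchy integral. -/

theorem not_injOn_of_eventuallyEq_pow_mul {f : ℂ → ℂ} {z : ℂ} {n : ℕ} (hn : 2 ≤ n)
    {g : ℂ → ℂ} (hg : AnalyticAt ℂ g z) (hgz : g z ≠ 0)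
    (hfg : ∀ᶠ w in 𝓝 z, f w - f z = (w - z) ^ n * g w) {U : Set ℂ} (hU : U ∈ 𝓝 z) :
    ¬ InjOn f U := by
  intro hinj
  have hn0 : (n : ℂ) ≠ 0 := by exact_mod_cast (by omega : n ≠ 0)
  obtain ⟨b, hb⟩ := IsAlgClosed.exists_pow_nat_eq (g z) (by omega : 0 < n)
  have hb0 : b ≠ 0 := by
    rintro rfl
    rw [zero_pow (by omega)] at hb
    exact hgz hb.symm
  -- `k` is a local holomorphic `n`-th root of `g`; dividing by `g z` keeps the power away from its
  -- branch cut. Hence `f - f z = u ^ n` with `u` locally invertible, and the values `ε/2` and `ω *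
  -- ε/2` of `u` have equal `n`-th powers.
  set k : ℂ → ℂ := fun w => b * (g w / g z) ^ (1 / n : ℂ) with hk
  have hslit : g z / g z ∈ Complex.slitPlane := by rw [div_self hgz]; simp
  have hkan : AnalyticAt ℂ k z :=
    analyticAt_const.mul ((hg.div analyticAt_const hgz).cpow analyticAt_const hslit)
  have hkz : k z = b := by simp [hk, div_self hgz]
  have hkn : ∀ w, k w ^ n = g w := by
    intro w
    simp only [hk, mul_pow, hb]
    rw [one_div, Complex.cpow_nat_inv_pow _ (by omega)]
    field_simp
  set u : ℂ → ℂ := fun w => (w - z) * k w with hu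
  have huan : AnalyticAt ℂ u z := (analyticAt_id.sub analyticAt_const).mul hkan
  have huz : u z = 0 := by simp [hu]
  have hder : HasDerivAt u b z := by
    have h1 := ((hasDerivAt_id z).sub_const z).mul hkan.differentiableAt.hasDerivAt
    exact h1.congr_deriv (by simp [hkz])
  have hstrict : HasStrictDerivAt u b z := by
    have := huan.hasStrictDerivAt
    rwa [hder.deriv] at this
  have hmap := hstrict.map_nhds_eq hb0
  rw [huz] at hmap
  have hW : u '' (U ∩ {w | f w - f z = (w - z) ^ n * g w}) ∈ 𝓝 (0 : ℂ) := by
    rw [← hmap]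
    exact image_mem_map (inter_mem hU hfg)
  obtain ⟨ε, hε, hball⟩ := Metric.mem_nhds_iff.1 hW
  set ω : ℂ := Complex.exp (2 * Real.pi * Complex.I / n) with hω
  have hωp : IsPrimitiveRoot ω n := Complex.isPrimitiveRoot_exp n (by omega)
  have hω1 : ω ≠ 1 := hωp.ne_one (by omega)
  have hωn : ‖ω‖ = 1 := hωp.norm'_eq_one (by omega)
  have hε2 : ‖((ε / 2 : ℝ) : ℂ)‖ < ε := by
    rw [Complex.norm_real, Real.norm_eq_abs, abs_of_pos (by positivity)]; linarith
  obtain ⟨w₁, ⟨hw₁U, hw₁⟩, h₁⟩ := hball (mem_ball_zero_iff.2 hε2)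
  obtain ⟨w₂, ⟨hw₂U, hw₂⟩, h₂⟩ := hball (a := ω * ((ε / 2 : ℝ) : ℂ))
    (mem_ball_zero_iff.2 (by rw [norm_mul, hωn, one_mul]; exact hε2))
  have key : ∀ w, f w - f z = (w - z) ^ n * g w → f w - f z = u w ^ n := by
    intro w hw
    rw [hw, hu, mul_pow, hkn]
  have e1 := key _ hw₁
  have e2 := key _ hw₂
  rw [h₁] at e1
  rw [h₂, mul_pow, hωp.pow_eq_one, one_mul] at e2
  have : w₁ = w₂ := hinj hw₁U hw₂U (by linear_combination e1 - e2)
  rw [this, h₂] at h₁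
  have hne : ((ε / 2 : ℝ) : ℂ) ≠ 0 := by
    exact_mod_cast (by positivity : (ε / 2 : ℝ) ≠ 0)
  exact hω1 (mul_right_cancel₀ hne (by rw [h₁, one_mul]))

/-- The derivative of a univalent function does not vanish. -/
theorem deriv_ne_zero_of_injOn {f : ℂ → ℂ} {U : Set ℂ} (hU : IsOpen U)
    (hf : DifferentiableOn ℂ f U) (hinj : InjOn f U) {z : ℂ} (hz : z ∈ U) : deriv f z ≠ 0 := by
  intro hd
  have han : AnalyticAt ℂ f z := hf.analyticAt (hU.mem_nhds hz)
  have hsub : AnalyticAt ℂ (fun w => f w - f z) z := han.sub analyticAt_const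
  by_cases htop : analyticOrderAt (fun w => f w - f z) z = ⊤
  · rw [analyticOrderAt_eq_top] at htop
    have h1 : ∀ᶠ w in 𝓝[≠] z, f w - f z = 0 ∧ w ∈ U :=
      (htop.and (hU.mem_nhds hz)).filter_mono nhdsWithin_le_nhds
    obtain ⟨w, ⟨hw, hwU⟩, hwz⟩ := (h1.and self_mem_nhdsWithin).exists
    exact hwz (hinj hwU hz (sub_eq_zero.1 hw))
  · obtain ⟨g, hg, hgz, hfg⟩ := hsub.analyticOrderAt_ne_top.1 htop
    set n := analyticOrderNatAt (fun w => f w - f z) z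
    refine not_injOn_of_eventuallyEq_pow_mul (n := n) ?_ hg hgz
      (by simpa [smul_eq_mul, EventuallyEq] using hfg) (hU.mem_nhds hz) hinj
    by_contra hlt
    have hn : n = 0 ∨ n = 1 := by omega
    rcases hn with hn | hn
    · have := hfg.self_of_nhds
      rw [hn] at this
      simp at this
      exact hgz this.symm
    · rw [hn] at hfg
      have hder : HasDerivAt (fun w => (w - z) * g w) (g z) z := by
        have h1 := ((hasDerivAt_id z).sub_const z).mul hg.differentiableAt.hasDerivAt
        exact h1.congr_deriv (by simp)
      have h2 : HasDerivAt (fun w => f w - f z) (g z) z :=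
        hder.congr_of_eventuallyEq (by simpa [smul_eq_mul] using hfg)
      have h3 := (han.differentiableAt.hasDerivAt.sub_const (f z)).unique h2
      exact hgz (by rw [← h3, hd])

theorem hasStrictDerivAt_of_differentiableOn {f : ℂ → ℂ} {U : Set ℂ} (hU : IsOpen U)
    (hf : DifferentiableOn ℂ f U) {z : ℂ} (hz : z ∈ U) : HasStrictDerivAt f (deriv f z) z :=
  (hf.analyticAt (hU.mem_nhds hz)).hasStrictDerivAt

theorem isOpen_image_of_injOn {f : ℂ → ℂ} {U : Set ℂ} (hU : IsOpen U)
    (hf : DifferentiableOn ℂ f U) (hinj : InjOn f U) : IsOpen (f '' U) := by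
  rw [isOpen_iff_mem_nhds]
  rintro _ ⟨z, hz, rfl⟩
  rw [← (hasStrictDerivAt_of_differentiableOn hU hf hz).map_nhds_eq
    (deriv_ne_zero_of_injOn hU hf hinj hz)]
  exact image_mem_map (hU.mem_nhds hz)

/-- The inverse of a univalent function is holomorphic. -/
theorem differentiableOn_invFunOn {f : ℂ → ℂ} {U : Set ℂ} (hU : IsOpen U)
    (hf : DifferentiableOn ℂ f U) (hinj : InjOn f U) :
    DifferentiableOn ℂ (Function.invFunOn f U) (f '' U) := by
  rintro _ ⟨z, hz, rfl⟩
  have hs := hasStrictDerivAt_of_differentiableOn hU hf hz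
  have hd := deriv_ne_zero_of_injOn hU hf hinj hz
  have hev : ∀ᶠ y in 𝓝 (f z),
      hs.localInverse f (deriv f z) z hd y = Function.invFunOn f U y := by
    rw [← hs.map_nhds_eq hd, eventually_map]
    filter_upwards [(hs.hasStrictFDerivAt_equiv hd).eventually_left_inverse, hU.mem_nhds hz]
      with x hx hxU
    rw [hinj.leftInvOn_invFunOn hxU]
    exact hx
  exact ((hs.to_localInverse hd).hasDerivAt.differentiableAt.congr_of_eventuallyEq
    (hev.mono fun _ h => h.symm)).differentiableWithinAt

/-! ### Self-maps of the unit disc -/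

/-- The automorphism of the unit disc that sends `0` to `a`. -/
noncomputable def discShift (a z : ℂ) : ℂ := (z + a) / (1 + (starRingEnd ℂ) a * z)

theorem normSq_one_add_conj_mul_sub (a z : ℂ) :
    ‖1 + (starRingEnd ℂ) a * z‖ ^ 2 - ‖z + a‖ ^ 2 = (1 - ‖a‖ ^ 2) * (1 - ‖z‖ ^ 2) := by
  simp only [← Complex.normSq_eq_norm_sq, Complex.normSq_apply, Complex.add_re, Complex.add_im,
    Complex.mul_re, Complex.mul_im, Complex.conj_re, Complex.conj_im, Complex.one_re,
    Complex.one_im]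
  ring

theorem one_add_conj_mul_ne_zero {a z : ℂ} (ha : ‖a‖ < 1) (hz : ‖z‖ ≤ 1) :
    1 + (starRingEnd ℂ) a * z ≠ 0 := by
  intro h
  have h1 : ‖(starRingEnd ℂ) a * z‖ < 1 := by
    rw [norm_mul, RCLike.norm_conj]
    nlinarith [norm_nonneg a, norm_nonneg z]
  have h2 : (starRingEnd ℂ) a * z = -1 := by linear_combination h
  rw [h2] at h1
  simp at h1

/-- `‖z‖ = 1` is allowed because this is applied to values of `dslope g 0`, bounded only by `1`. -/
theorem one_sub_normSq_discShift {a z : ℂ} (ha : ‖a‖ < 1) (hz : ‖z‖ ≤ 1) :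
    (1 - ‖discShift a z‖ ^ 2) * ‖1 + (starRingEnd ℂ) a * z‖ ^ 2 =
      (1 - ‖a‖ ^ 2) * (1 - ‖z‖ ^ 2) := by
  rw [← normSq_one_add_conj_mul_sub, discShift, norm_div]
  have := norm_ne_zero_iff.2 (one_add_conj_mul_ne_zero ha hz)
  rw [div_pow, sub_mul, div_mul_cancel₀ _ (pow_ne_zero 2 this), one_mul]

theorem norm_discShift_lt_one {a z : ℂ} (ha : ‖a‖ < 1) (hz : ‖z‖ < 1) :
    ‖discShift a z‖ < 1 := by
  have h := one_sub_normSq_discShift ha hz.le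
  have h1 : 0 < (1 - ‖a‖ ^ 2) * (1 - ‖z‖ ^ 2) := by
    apply mul_pos <;> nlinarith [norm_nonneg a, norm_nonneg z]
  rw [← h] at h1
  have h2 := pos_of_mul_pos_left h1 (sq_nonneg _)
  nlinarith [norm_nonneg (discShift a z)]

theorem discShift_neg_discShift {a z : ℂ} (ha : ‖a‖ < 1) (hz : ‖z‖ < 1) :
    discShift (-a) (discShift a z) = z := by
  have h0 := one_add_conj_mul_ne_zero ha hz.le
  have h1 := one_add_conj_mul_ne_zero (a := -a) (by simpa using ha)
    (norm_discShift_lt_one ha hz).le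
  unfold discShift at h1 ⊢
  rw [div_eq_iff h1]
  simp only [map_neg]
  linear_combination div_mul_cancel₀ (z + a) h0

theorem differentiableOn_discShift {a : ℂ} (ha : ‖a‖ < 1) :
    DifferentiableOn ℂ (discShift a) (ball 0 1) := by
  intro z hz
  have h0 := one_add_conj_mul_ne_zero ha (mem_ball_zero_iff.1 hz).le
  unfold discShift
  exact ((differentiableAt_id.add_const a).div
    ((differentiableAt_id.const_mul _).const_add 1) h0).differentiableWithinAt

theorem bijOn_discShift {a : ℂ} (ha : ‖a‖ < 1) :
    BijOn (discShift a) (ball 0 1) (ball 0 1) := by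
  have hm : ∀ b : ℂ, ‖b‖ < 1 → MapsTo (discShift b) (ball 0 1) (ball 0 1) := fun b hb z hz =>
    mem_ball_zero_iff.2 (norm_discShift_lt_one hb (mem_ball_zero_iff.1 hz))
  have ha' : ‖-a‖ < 1 := by rwa [norm_neg]
  refine InvOn.bijOn (f' := discShift (-a)) ⟨fun z hz => ?_, fun z hz => ?_⟩ (hm a ha) (hm _ ha')
  · exact discShift_neg_discShift ha (mem_ball_zero_iff.1 hz)
  · simpa using discShift_neg_discShift ha' (mem_ball_zero_iff.1 hz)

theorem IsConformalFromDisc.exists_normalized {φ : ℂ → ℂ} {U : Set ℂ}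
    (hφ : IsConformalFromDisc φ U) {w : ℂ} (hw : w ∈ U) :
    ∃ ψ : ℂ → ℂ, IsConformalFromDisc ψ U ∧ ψ 0 = w := by
  obtain ⟨a, ha, rfl⟩ := hφ.2.surjOn hw
  have ha' := mem_ball_zero_iff.1 ha
  have hb := bijOn_discShift ha'
  exact ⟨φ ∘ discShift a, ⟨hφ.1.comp (differentiableOn_discShift ha') hb.mapsTo, hφ.2.comp hb⟩,
    by simp [discShift]⟩

section SelfMap

variable {g : ℂ → ℂ}

theorem norm_dslope_le_one (hg : DifferentiableOn ℂ g (ball 0 1))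
    (hm : MapsTo g (ball 0 1) (ball 0 1)) (h0 : g 0 = 0) {z : ℂ} (hz : z ∈ ball (0 : ℂ) 1) :
    ‖dslope g 0 z‖ ≤ 1 := by
  have := Complex.norm_dslope_le_div_of_mapsTo_ball hg (R₂ := 1)
    (by rw [h0]; exact hm.mono_right ball_subset_closedBall) hz
  simpa using this

theorem eq_mul_dslope (h0 : g 0 = 0) (z : ℂ) : g z = z * dslope g 0 z := by
  have := sub_smul_dslope g 0 z
  simpa [h0] using this.symm

theorem norm_le_norm_of_mapsTo_disc (hg : DifferentiableOn ℂ g (ball 0 1))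
    (hm : MapsTo g (ball 0 1) (ball 0 1)) (h0 : g 0 = 0) {z : ℂ} (hz : z ∈ ball (0 : ℂ) 1) :
    ‖g z‖ ≤ ‖z‖ := by
  rw [eq_mul_dslope h0, norm_mul]
  exact mul_le_of_le_one_right (norm_nonneg _) (norm_dslope_le_one hg hm h0 hz)

theorem differentiableOn_dslope_zero (hg : DifferentiableOn ℂ g (ball 0 1)) :
    DifferentiableOn ℂ (dslope g 0) (ball 0 1) :=
  (Complex.differentiableOn_dslope (isOpen_ball.mem_nhds (by simp))).2 hg

/-- A holomorphic self-map of the disc fixing `0` with derivative at `0` of modulus at least `1/2`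
is injective on the disc of radius `1/16`. -/
theorem injOn_ball_of_half_le_norm_deriv (hg : DifferentiableOn ℂ g (ball 0 1))
    (hm : MapsTo g (ball 0 1) (ball 0 1)) (h0 : g 0 = 0) (hd : 1 / 2 ≤ ‖deriv g 0‖) :
    InjOn g (ball 0 (1 / 16)) := by
  set h := dslope g 0 with hh
  have hhd : DifferentiableOn ℂ h (ball 0 1) := differentiableOn_dslope_zero hg
  have hh1 : ∀ z ∈ ball (0 : ℂ) 1, ‖h z‖ ≤ 1 := fun z hz => norm_dslope_le_one hg hm h0 hz
  -- Cauchy estimate on circles of radius `1/2`, with `‖h‖ ≤ 1`.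
  have hder : ∀ z ∈ ball (0 : ℂ) (1 / 16), ‖deriv h z‖ ≤ 2 := by
    intro z hz
    have hsub : closedBall z (1 / 2) ⊆ ball (0 : ℂ) 1 := by
      apply closedBall_subset_ball'
      rw [mem_ball] at hz
      linarith
    have hcl : DiffContOnCl ℂ h (ball z (1 / 2)) :=
      DifferentiableOn.diffContOnCl_ball hhd hsub
    have := Complex.norm_deriv_le_of_forall_mem_sphere_norm_le (by norm_num) hcl
      (C := 1) (fun w hw => hh1 w (hsub (sphere_subset_closedBall hw)))
    linarith
  have hlip : ∀ z ∈ ball (0 : ℂ) (1 / 16), ∀ w ∈ ball (0 : ℂ) (1 / 16),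
      ‖h w - h z‖ ≤ 2 * ‖w - z‖ := by
    intro z hz w hw
    refine (convex_ball (0 : ℂ) (1 / 16)).norm_image_sub_le_of_norm_deriv_le (fun x hx => ?_)
      hder hz hw
    exact hhd.differentiableAt (isOpen_ball.mem_nhds (ball_subset_ball (by norm_num) hx))
  intro z hz w hw hzw
  by_contra hne
  have hz' := mem_ball_zero_iff.1 hz
  have hw' := mem_ball_zero_iff.1 hw
  have hh0 : 1 / 2 ≤ ‖h 0‖ := by simpa [hh] using hd
  have h1 : 1 / 4 ≤ ‖h z‖ := by
    have a1 := hlip z hz 0 (by simp)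
    have a2 := norm_sub_norm_le (h 0) (h z)
    rw [zero_sub, norm_neg] at a1
    linarith
  -- The left side has norm at least `‖z - w‖ / 4`, the right side at most `‖z - w‖ / 8`.
  have e : (z - w) * h z = w * (h w - h z) := by
    rw [eq_mul_dslope h0 z, eq_mul_dslope h0 w] at hzw
    linear_combination hzw
  have e' := congrArg norm e
  rw [norm_mul, norm_mul] at e'
  have hpos : 0 < ‖z - w‖ := norm_pos_iff.2 (sub_ne_zero.2 hne)
  have h2 := hlip z hz w hw
  rw [norm_sub_rev w z] at h2
  have h3 : ‖w‖ * ‖h w - h z‖ ≤ 1 / 16 * (2 * ‖z - w‖) := by gcongr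
  have h4 : ‖z - w‖ * (1 / 4) ≤ ‖z - w‖ * ‖h z‖ := by gcongr
  linarith

/-- A holomorphic self-map of the disc fixing `0` with derivative at `0` of modulus at most `1/2`
contracts towards `0` by a factor depending only on the modulus of the point. -/
theorem norm_le_mul_of_norm_deriv_le_half (hg : DifferentiableOn ℂ g (ball 0 1))
    (hm : MapsTo g (ball 0 1) (ball 0 1)) (h0 : g 0 = 0) (hd : ‖deriv g 0‖ ≤ 1 / 2)
    {ρ : ℝ} (hρ : ρ < 1) {z : ℂ} (hz : ‖z‖ ≤ ρ) :
    ‖g z‖ ≤ √(1 - (1 - ρ ^ 2) / 4) * ‖z‖ := by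
  set h := dslope g 0 with hh
  have hρ0 : 0 ≤ ρ := (norm_nonneg z).trans hz
  have hz1 : z ∈ ball (0 : ℂ) 1 := mem_ball_zero_iff.2 (hz.trans_lt hρ)
  have hhd : DifferentiableOn ℂ h (ball 0 1) := differentiableOn_dslope_zero hg
  have hh1 : ∀ z ∈ ball (0 : ℂ) 1, ‖h z‖ ≤ 1 := fun z hz => norm_dslope_le_one hg hm h0 hz
  have hh0 : ‖h 0‖ ≤ 1 / 2 := by simpa [hh] using hd
  have hneg : ‖-h 0‖ < 1 := by rw [norm_neg]; linarith
  -- Moving `h 0` to `0` makes the Schwarz lemma applicable to `k`: `‖k z‖ ≤ ρ`. Undoing the shift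
  -- bounds `‖h z‖` away from `1`; the factor `1/4` is the square of the lower bound `hlow` for the
  -- denominator.
  set k : ℂ → ℂ := fun w => discShift (-h 0) (h w) with hk
  have hkd : DifferentiableOn ℂ k (ball 0 1) := by
    intro w hw
    have hne := one_add_conj_mul_ne_zero hneg (hh1 w hw)
    exact ((hhd w hw).add_const _).div (((hhd w hw).const_mul _).const_add 1) hne
  have hk0 : k 0 = 0 := by simp [hk, discShift]
  have hkm : MapsTo k (ball 0 1) (closedBall (k 0) 1) := by
    intro w hw
    rw [hk0, mem_closedBall_zero_iff]
    have h1 := one_sub_normSq_discShift hneg (hh1 w hw)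
    have hne := norm_pos_iff.2 (one_add_conj_mul_ne_zero hneg (hh1 w hw))
    by_contra hlt
    push Not at hlt
    have h2 : 0 ≤ (1 - ‖-h 0‖ ^ 2) * (1 - ‖h w‖ ^ 2) := by
      apply mul_nonneg <;> nlinarith [norm_nonneg (-h 0), norm_nonneg (h w), hh1 w hw]
    rw [← h1] at h2
    have h3 : (1 - ‖discShift (-h 0) (h w)‖ ^ 2) < 0 := by
      have : 1 < ‖discShift (-h 0) (h w)‖ := hlt
      nlinarith
    have := mul_neg_of_neg_of_pos h3 (pow_pos hne 2)
    linarith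
  have hkz : ‖k z‖ ≤ ρ := by
    have := Complex.dist_le_div_mul_dist_of_mapsTo_ball hkd hkm hz1
    rw [hk0, dist_zero_right, dist_zero_right] at this
    linarith
  have h1 := one_sub_normSq_discShift hneg (hh1 z hz1)
  have hlow : 1 / 2 ≤ ‖1 + (starRingEnd ℂ) (-h 0) * h z‖ := by
    have a1 := norm_sub_le_norm_add (1 : ℂ) ((starRingEnd ℂ) (-h 0) * h z)
    have a2 : ‖(starRingEnd ℂ) (-h 0) * h z‖ ≤ 1 / 2 * 1 := by
      rw [norm_mul, RCLike.norm_conj, norm_neg]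
      gcongr
      exact hh1 z hz1
    rw [norm_one] at a1
    linarith
  have hsq : ‖h z‖ ^ 2 ≤ 1 - (1 - ρ ^ 2) / 4 := by
    have hk2 : 1 - ρ ^ 2 ≤ 1 - ‖discShift (-h 0) (h z)‖ ^ 2 := by
      have : ‖discShift (-h 0) (h z)‖ ≤ ρ := hkz
      gcongr
    have hρ2 : 0 ≤ 1 - ρ ^ 2 := by nlinarith
    have hk3 := hρ2.trans hk2
    have b1 : (1 - ρ ^ 2) * (1 / 2) ^ 2 ≤
        (1 - ‖discShift (-h 0) (h z)‖ ^ 2) * ‖1 + (starRingEnd ℂ) (-h 0) * h z‖ ^ 2 := by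
      gcongr
    rw [h1] at b1
    have b2 : (1 - ‖-h 0‖ ^ 2) * (1 - ‖h z‖ ^ 2) ≤ 1 * (1 - ‖h z‖ ^ 2) := by
      have : 0 ≤ 1 - ‖h z‖ ^ 2 := by nlinarith [norm_nonneg (h z), hh1 z hz1]
      gcongr
      nlinarith [norm_nonneg (-h 0)]
    linarith
  rw [eq_mul_dslope h0 z, norm_mul, mul_comm]
  gcongr
  exact Real.le_sqrt_of_sq_le hsq

end SelfMap

/-! ### Fibres and critical points of iterates -/

/-- By the identity theorem the fibre is discrete, and the plane is Lindelöf. -/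
theorem countable_fiber {f : ℂ → ℂ} (hf : Differentiable ℂ f) {c : ℂ} (hc : ∃ z, f z ≠ c) :
    {z | f z = c}.Countable := by
  have han : AnalyticOnNhd ℂ f univ := fun z _ => hf.analyticAt z
  rcases han.eqOn_or_eventually_ne_of_preconnected (g := fun _ => c) analyticOnNhd_const
    isPreconnected_univ with h | h
  · obtain ⟨z, hz⟩ := hc
    exact absurd (h (mem_univ z)) hz
  · have hd : IsDiscrete {z | f z = c} := by
      rw [← inter_univ {z | f z = c}]
      apply isDiscrete_of_codiscreteWithin (U := univ)
      filter_upwards [h] with z hz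
      exact hz
    have := hd.to_subtype
    exact countable_coe_iff.1 countable_of_Lindelof_of_discrete

theorem countable_preimage {f : ℂ → ℂ} (hf : Differentiable ℂ f)
    (hne : ∀ c, ∃ z, f z ≠ c) {S : Set ℂ} (hS : S.Countable) : (f ⁻¹' S).Countable := by
  have : f ⁻¹' S = ⋃ c ∈ S, {z | f z = c} := by ext; simp
  rw [this]
  exact hS.biUnion fun c _ => countable_fiber hf (hne c)

theorem countable_fiber_iterate {f : ℂ → ℂ} (hf : Differentiable ℂ f)
    (hne : ∀ c, ∃ z, f z ≠ c) (n : ℕ) (c : ℂ) : {z | f^[n] z = c}.Countable := by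
  induction n with
  | zero => simp
  | succ n ih => exact countable_preimage hf hne ih

theorem countable_deriv_iterate_eq_zero {f : ℂ → ℂ} (hf : Differentiable ℂ f)
    (hne : ∀ c, ∃ z, f z ≠ c) (n : ℕ) : {z | deriv f^[n] z = 0}.Countable := by
  have h1 : {z | deriv f z = 0}.Countable := by
    refine countable_fiber hf.deriv ?_
    by_contra! h
    obtain ⟨z, hz⟩ := hne (f 0)
    exact hz (is_const_of_deriv_eq_zero hf h z 0)
  induction n with
  | zero => simp
  | succ n ih =>
    refine (h1.union (countable_preimage hf hne ih)).mono fun z hz => ?_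
    have h2 : deriv f^[n + 1] z = deriv f^[n] (f z) * deriv f z := by
      rw [Function.iterate_succ]
      exact deriv_comp z (hf.iterate n).differentiableAt hf.differentiableAt
    rw [mem_ofPred_eq, h2, mul_eq_zero] at hz
    exact hz.symm

theorem IsTranscendentalEntire.exists_ne {f : ℂ → ℂ} (hf : IsTranscendentalEntire f) (c : ℂ) :
    ∃ z, f z ≠ c := by
  by_contra! h
  exact hf.2 ⟨Polynomial.C c, fun z => by simp [h z]⟩

/-! ### Fatou components are open and nonempty -/

theorem isOpen_fatouSet (f : ℂ → ℂ) : IsOpen (fatouSet f) := by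
  rw [isOpen_iff_mem_nhds]
  rintro z ⟨W, hW, hc, hz, hn⟩
  exact mem_of_superset (hW.mem_nhds hz) fun w hw => ⟨W, hW, hc, hw, hn⟩

theorem IsFatouComponent.isOpen {f : ℂ → ℂ} {U : Set ℂ} (h : IsFatouComponent f U) :
    IsOpen U := by
  obtain ⟨z, -, rfl⟩ := h
  exact (isOpen_fatouSet f).connectedComponentIn

theorem IsFatouComponent.nonempty {f : ℂ → ℂ} {U : Set ℂ} (h : IsFatouComponent f U) :
    U.Nonempty := by
  obtain ⟨z, hz, rfl⟩ := h
  exact ⟨z, mem_connectedComponentIn hz⟩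

theorem exists_mem_diff_of_countable {U S : Set ℂ} (hU : IsOpen U) (hne : U.Nonempty)
    (hS : S.Countable) : ∃ z ∈ U, z ∉ S := by
  obtain ⟨z, hz⟩ := hne
  obtain ⟨w, hw, hwS⟩ := (hS.dense_compl ℝ).inter_open_nonempty U hU ⟨z, hz⟩
  exact ⟨w, hw, hwS⟩

/-! ### Hyperbolic distance -/

theorem discDist_nonneg (a b : ℂ) : 0 ≤ discDist a b :=
  mul_nonneg zero_le_two (Real.artanh_nonneg (norm_nonneg _))

/-- An upper bound from one Riemann map suffices below, so independence of the choice of map is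
never needed. -/
theorem hyperbolicDist_le {φ : ℂ → ℂ} {U : Set ℂ} (hφ : IsConformalFromDisc φ U) {a b : ℂ}
    (ha : a ∈ ball (0 : ℂ) 1) (hb : b ∈ ball (0 : ℂ) 1) :
    hyperbolicDist U (φ a) (φ b) ≤ discDist a b := by
  refine csInf_le ⟨0, ?_⟩ ⟨φ, hφ, a, ha, b, hb, rfl, rfl, rfl⟩
  rintro r ⟨-, -, a, -, b, -, -, -, rfl⟩
  exact discDist_nonneg a b

/-- Since `sInf ∅ = 0`, a nonzero distance itself provides a Riemann map. -/
theorem exists_isConformalFromDisc_of_hyperbolicDist_ne_zero {U : Set ℂ} {z w : ℂ}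
    (h : hyperbolicDist U z w ≠ 0) : ∃ φ : ℂ → ℂ, IsConformalFromDisc φ U := by
  by_contra! hno
  refine h ?_
  unfold hyperbolicDist
  convert Real.sInf_empty
  ext r
  simp [hno]

/-! ### Non-autonomous self-maps of the disc -/

/-- If an orbit of a sequence of holomorphic self-maps of the disc fixing `0` does not tend to `0`,
then the derivatives at `0` eventually have modulus at least `1/2`. -/
theorem eventually_half_le_norm_deriv {g : ℕ → ℂ → ℂ}
    (hg : ∀ n, DifferentiableOn ℂ (g n) (ball 0 1))
    (hm : ∀ n, MapsTo (g n) (ball 0 1) (ball 0 1)) (h0 : ∀ n, g n 0 = 0) {w : ℕ → ℂ}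
    (hw : w 0 ∈ ball (0 : ℂ) 1) (hgw : ∀ n, w (n + 1) = g n (w n))
    (hnt : ¬ Tendsto (fun n => ‖w n‖) atTop (𝓝 0)) :
    ∀ᶠ n in atTop, 1 / 2 ≤ ‖deriv (g n) 0‖ := by
  by_contra hev
  have hfr : ∃ᶠ n in atTop, ‖deriv (g n) 0‖ < 1 / 2 := by
    simpa only [not_eventually, not_le] using hev
  have hmem : ∀ n, w n ∈ ball (0 : ℂ) 1 := by
    intro n
    induction n with
    | zero => exact hw
    | succ n ih => rw [hgw]; exact hm n ih
  have hanti : Antitone fun n => ‖w n‖ := antitone_nat_of_succ_le fun n => by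
    rw [hgw]
    exact norm_le_norm_of_mapsTo_disc (hg n) (hm n) (h0 n) (hmem n)
  obtain ⟨l, hl⟩ : ∃ l, Tendsto (fun n => ‖w n‖) atTop (𝓝 l) :=
    ⟨_, tendsto_atTop_ciInf hanti ⟨0, by rintro _ ⟨n, rfl⟩; exact norm_nonneg _⟩⟩
  set ρ := ‖w 0‖ with hρ
  have hρ1 : ρ < 1 := mem_ball_zero_iff.1 hw
  set q := √(1 - (1 - ρ ^ 2) / 4) with hq
  have hq1 : q < 1 := by
    rw [hq, Real.sqrt_lt' one_pos]
    nlinarith [norm_nonneg (w 0)]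
  -- The moduli decrease to `l`, and infinitely often shrink by the factor `q`, so `l ≤ q * l` and
  -- `l = 0`.
  have hlim : Tendsto (fun n => ‖w (n + 1)‖ - q * ‖w n‖) atTop (𝓝 (l - q * l)) :=
    ((tendsto_add_atTop_iff_nat 1).2 hl).sub (hl.const_mul q)
  have hle : l - q * l ≤ 0 := by
    refine le_of_tendsto_of_frequently hlim (hfr.mono fun n hn => ?_)
    have := norm_le_mul_of_norm_deriv_le_half (hg n) (hm n) (h0 n) hn.le hρ1
      (hanti (Nat.zero_le n))
    rw [hgw]
    linarith
  have hl0 : 0 ≤ l := ge_of_tendsto' hl fun n => norm_nonneg _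
  have : l = 0 := by nlinarith
  exact hnt (this ▸ hl)

/-! ### Injectivity of all iterates -/

theorem injOn_iterate_of_forall {f : ℂ → ℂ} {W : ℕ → Set ℂ} (hm : ∀ n, MapsTo f (W n) (W (n + 1)))
    (hinj : ∀ n, InjOn f (W n)) (n : ℕ) : MapsTo f^[n] (W 0) (W n) ∧ InjOn f^[n] (W 0) := by
  induction n with
  | zero => exact ⟨mapsTo_id _, injOn_id _⟩
  | succ n ih =>
    rw [Function.iterate_succ']
    exact ⟨(hm n).comp ih.1, (hinj n).comp ih.2 ih.1⟩

/-- The map `f : U → U'`, read in Riemann maps of `U` and `U'`. -/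
theorem exists_conjugate {f φ φ' : ℂ → ℂ} {U U' : Set ℂ} (hf : Differentiable ℂ f)
    (hm : MapsTo f U U') (hφ : IsConformalFromDisc φ U) (hφ' : IsConformalFromDisc φ' U') :
    ∃ g : ℂ → ℂ, DifferentiableOn ℂ g (ball 0 1) ∧ MapsTo g (ball 0 1) (ball 0 1) ∧
      ∀ z ∈ ball (0 : ℂ) 1, φ' (g z) = f (φ z) := by
  have hmaps : MapsTo (fun z => f (φ z)) (ball 0 1) (φ' '' ball 0 1) := fun z hz => by
    rw [hφ'.2.image_eq]
    exact hm (hφ.2.mapsTo hz)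
  refine ⟨fun z => Function.invFunOn φ' (ball 0 1) (f (φ z)), ?_, fun z hz => ?_, fun z hz => ?_⟩
  · exact (differentiableOn_invFunOn isOpen_ball hφ'.1 hφ'.2.injOn).comp
      (hf.comp_differentiableOn hφ.1) hmaps
  · exact Function.invFunOn_mem (hmaps hz)
  · exact Function.invFunOn_eq (hmaps hz)

/-- If, after a normalization, an orbit in a sequence of simply connected domains does not approach
a base orbit in the hyperbolic sense, then from some time on all iterates of `f` are injective on a
fixed neighbourhood of the base orbit. -/
theorem exists_nhds_forall_injOn_iterate {f : ℂ → ℂ} (hf : Differentiable ℂ f) {U : ℕ → Set ℂ}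
    (hm : ∀ n, MapsTo f (U n) (U (n + 1))) {z w : ℕ → ℂ} (hz : ∀ n, z n ∈ U n)
    (hw : ∀ n, w n ∈ U n) (hfz : ∀ n, z (n + 1) = f (z n)) (hfw : ∀ n, w (n + 1) = f (w n))
    {c : ℝ} (hc : 0 < c)
    (hlim : Tendsto (fun n => hyperbolicDist (U n) (z n) (w n)) atTop (𝓝 c)) :
    ∃ N, ∃ W ∈ 𝓝 (z N), ∀ n, InjOn f^[n] W := by
  obtain ⟨N, hN⟩ := eventually_atTop.1 (hlim.eventually_ne hc.ne')
  have hex : ∀ n, ∃ φ : ℂ → ℂ, IsConformalFromDisc φ (U (N + n)) ∧ φ 0 = z (N + n) := fun n => by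
    obtain ⟨φ, hφ⟩ := exists_isConformalFromDisc_of_hyperbolicDist_ne_zero
      (hN (N + n) (Nat.le_add_right _ _))
    exact hφ.exists_normalized (hz _)
  choose φ hφ hφ0 using hex
  choose g hgd hgm hg using fun n => exists_conjugate hf (hm (N + n)) (hφ n) (hφ (n + 1))
  have h01 : (0 : ℂ) ∈ ball (0 : ℂ) 1 := mem_ball_self one_pos
  have hg0 : ∀ n, g n 0 = 0 := fun n => by
    refine (hφ (n + 1)).2.injOn (hgm n h01) h01 ?_
    rw [hg n 0 h01, hφ0, hφ0, ← hfz]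
    rfl
  choose v hv hφv using fun n => (hφ n).2.surjOn (hw (N + n))
  have hgv : ∀ n, v (n + 1) = g n (v n) := fun n => by
    refine (hφ (n + 1)).2.injOn (hv _) (hgm n (hv n)) ?_
    rw [hg n _ (hv n), hφv, hφv, ← hfw]
    rfl
  have hnt : ¬ Tendsto (fun n => ‖v n‖) atTop (𝓝 0) := by
    intro ht
    -- `discDist 0 v = 2 artanh ‖v‖`, so `‖v‖ < tanh (c/4)` keeps the distance at most `c/2`,
    -- against the limit `c`.
    have hpos : 0 < Real.tanh (c / 4) := by
      rw [Real.tanh_eq_sinh_div_cosh]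
      exact div_pos (Real.sinh_pos_iff.2 (by positivity)) (Real.cosh_pos _)
    have hlt : Real.tanh (c / 4) < 1 := Real.tanh_lt_one _
    have hlim' : Tendsto (fun n => hyperbolicDist (U (N + n)) (z (N + n)) (w (N + n))) atTop
        (𝓝 c) := by
      simpa only [add_comm N] using (tendsto_add_atTop_iff_nat N).2 hlim
    have hle : c ≤ 2 * (c / 4) := by
      refine le_of_tendsto hlim' ((ht.eventually_lt_const hpos).mono fun n hn => ?_)
      have h1 := hyperbolicDist_le (hφ n) h01 (hv n)
      rw [hφ0, hφv] at h1
      refine h1.trans ?_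
      have h2 : discDist 0 (v n) = 2 * Real.artanh ‖v n‖ := by simp [discDist]
      rw [h2]
      have h3 := Real.artanh_le_artanh (by linarith [norm_nonneg (v n)]) hlt hn.le
      rw [Real.artanh_tanh] at h3
      linarith
    linarith
  obtain ⟨M, hM⟩ := eventually_atTop.1
    (eventually_half_le_norm_deriv hgd hgm hg0 (hv 0) hgv hnt)
  have hsub : ball (0 : ℂ) (1 / 16) ⊆ ball 0 1 := ball_subset_ball (by norm_num)
  -- By the Schwarz lemma each `g` maps the disc of radius `1/16` into itself, so the injective
  -- steps compose without further shrinking.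
  set W : ℕ → Set ℂ := fun n => φ (M + n) '' ball 0 (1 / 16) with hW
  have hWm : ∀ n, MapsTo f (W n) (W (n + 1)) := by
    rintro n _ ⟨x, hx, rfl⟩
    refine ⟨g (M + n) x, ?_, hg _ x (hsub hx)⟩
    rw [mem_ball_zero_iff] at hx ⊢
    exact (norm_le_norm_of_mapsTo_disc (hgd _) (hgm _) (hg0 _)
      (hsub (mem_ball_zero_iff.2 hx))).trans_lt hx
  have hWinj : ∀ n, InjOn f (W n) := by
    rintro n _ ⟨x, hx, rfl⟩ _ ⟨y, hy, rfl⟩ hxy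
    rw [← hg _ x (hsub hx), ← hg _ y (hsub hy)] at hxy
    have h1 := (hφ _).2.injOn (hgm _ (hsub hx)) (hgm _ (hsub hy)) hxy
    rw [injOn_ball_of_half_le_norm_deriv (hgd _) (hgm _) (hg0 _) (hM _ (Nat.le_add_right M n))
      hx hy h1]
  refine ⟨N + M, W 0, ?_, fun n => (injOn_iterate_of_forall hWm hWinj n).2⟩
  have hopen : IsOpen (W 0) := isOpen_image_of_injOn isOpen_ball ((hφ _).1.mono hsub)
    ((hφ _).2.injOn.mono hsub)
  rw [← hφ0 M]
  exact hopen.mem_nhds ⟨0, mem_ball_self (by norm_num), rfl⟩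

theorem exists_ball_forall_injOn_iterate {f : ℂ → ℂ} (hf : IsTranscendentalEntire f)
    {U : ℕ → Set ℂ} (hU : IsWanderingSequence f U) (hsemi : IsSemiContracting f U)
    (hm : ∀ n, MapsTo f (U n) (U (n + 1))) :
    ∃ z₀ : ℂ, ∃ r > 0, ball z₀ r ⊆ U 0 ∧ ∀ n, InjOn f^[n] (ball z₀ r) := by
  have hUo := hU.1.1.isOpen
  have hne := hf.exists_ne
  obtain ⟨z₀, hz₀, hcrit⟩ := exists_mem_diff_of_countable hUo hU.1.1.nonempty
    (countable_iUnion fun n => countable_deriv_iterate_eq_zero hf.1 hne n)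
  obtain ⟨w₀, hw₀, hmerge⟩ := exists_mem_diff_of_countable hUo hU.1.1.nonempty
    (countable_iUnion fun n => countable_fiber_iterate hf.1 hne n (f^[n] z₀))
  simp only [mem_iUnion, mem_ofPred_eq, not_exists] at hcrit hmerge
  obtain ⟨-, c, hc⟩ := hsemi
  obtain ⟨hlim, hpos, -⟩ := hc z₀ hz₀ w₀ hw₀ fun ⟨k, hk⟩ => hmerge k hk.symm
  obtain ⟨N, W, hW, hinj⟩ := exists_nhds_forall_injOn_iterate hf.1 hm
    (fun n => (hU.2 n).2 hz₀) (fun n => (hU.2 n).2 hw₀)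
    (fun n => Function.iterate_succ_apply' f n z₀) (fun n => Function.iterate_succ_apply' f n w₀)
    hpos hlim
  have hd : HasStrictDerivAt f^[N] (deriv f^[N] z₀) z₀ :=
    ((hf.1.iterate N).analyticAt z₀).hasStrictDerivAt
  obtain ⟨T, hT, hTinj⟩ : ∃ T ∈ 𝓝 z₀, InjOn f^[N] T := by
    refine ⟨_, (hd.hasStrictFDerivAt_equiv (hcrit N)).eventually_left_inverse, ?_⟩
    intro x hx y hy hxy
    rw [mem_ofPred_eq] at hx hy
    rw [← hx, ← hy, hxy]
  have hmem : T ∩ f^[N] ⁻¹' W ∩ U 0 ∈ 𝓝 z₀ :=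
    inter_mem (inter_mem hT ((hf.1.iterate N).continuous.continuousAt hW)) (hUo.mem_nhds hz₀)
  obtain ⟨r, hr, hball⟩ := Metric.mem_nhds_iff.1 hmem
  refine ⟨z₀, r, hr, fun x hx => (hball hx).2, fun n => ?_⟩
  have key : ∀ k, InjOn f^[k + N] (ball z₀ r) := fun k => by
    rw [Function.iterate_add]
    exact (hinj k).comp (hTinj.mono fun x hx => (hball hx).1.1) fun x hx => (hball hx).1.2
  intro x hx y hy hxy
  -- Equality under `f^n` persists under `f^(n+N)`, which covers `n < N` as well.
  refine key n hx hy ?_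
  rw [add_comm, Function.iterate_add_apply, Function.iterate_add_apply, hxy]

/-! ### Continuous logarithms and unbounded complementary components -/

theorem exists_continuous_log {g : ℂ → ℂ} (hg : Continuous g) (h0 : ∀ z, g z ≠ 0) :
    ∃ h : ℂ → ℂ, Continuous h ∧ ∀ z, Complex.exp (h z) = g z := by
  have hsc : IsSimplyConnected (univ : Set ℂ) := by
    have : ContractibleSpace (univ : Set ℂ) := convex_univ.contractibleSpace univ_nonempty
    exact SimplyConnectedSpace.ofContractible _
  obtain ⟨h, hc, he⟩ := Complex.exists_continuousOn_eqOn_exp_comp hsc isOpen_univ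
    hg.continuousOn (by simpa using h0)
  exact ⟨h, continuousOn_univ.1 hc, fun z => he (mem_univ z)⟩

/-- Subtracting `iθ` from such a logarithm gives a lift of a constant through the covering `exp`.
The lift is constant, yet changes by `-2πi` around the circle. -/
theorem not_exists_continuous_log_circle (a : ℂ) (R : ℝ) :
    ¬ ∃ h : ℂ → ℂ, Continuous h ∧ ∀ θ : ℝ,
      Complex.exp (h (circleMap a R θ)) = circleMap a R θ - a := by
  rintro ⟨h, hc, he⟩
  have hcont : Continuous fun θ : ℝ => h (circleMap a R θ) - θ * Complex.I :=
    (hc.comp (continuous_circleMap a R)).sub (by fun_prop)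
  have hexp : ∀ θ : ℝ, Complex.exp (h (circleMap a R θ) - θ * Complex.I) = R := fun θ => by
    rw [Complex.exp_sub, he, circleMap_sub_center, circleMap_zero,
      mul_div_cancel_right₀ _ (Complex.exp_ne_zero _)]
  have hconst := Complex.isCoveringMap_exp.const_of_comp hcont
    (fun s t => Subtype.ext ((hexp s).trans (hexp t).symm)) 0 (2 * Real.pi)
  have hper : circleMap a R (2 * Real.pi) = circleMap a R 0 := by
    simpa using periodic_circleMap a R 0
  simp only [hper] at hconst
  push_cast at hconst
  have : (2 * Real.pi * Complex.I : ℂ) = 0 := by linear_combination hconst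
  exact Complex.two_pi_I_ne_zero this

/-- A frontier point outside `E` could be added to the component without losing connectedness. -/
theorem frontier_connectedComponentIn_compl_subset {E : Set ℂ} (hE : IsClosed E) (a : ℂ) :
    frontier (connectedComponentIn Eᶜ a) ⊆ E := by
  intro x hx
  by_contra hxE
  have hopen : IsOpen (connectedComponentIn Eᶜ a) := hE.isOpen_compl.connectedComponentIn
  rw [hopen.frontier_eq] at hx
  have hne : (connectedComponentIn Eᶜ a).Nonempty := by
    rw [← closure_nonempty_iff]
    exact ⟨x, hx.1⟩
  have ha : a ∈ connectedComponentIn Eᶜ a :=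
    mem_connectedComponentIn (connectedComponentIn_nonempty_iff.1 hne)
  have hpre : IsPreconnected (insert x (connectedComponentIn Eᶜ a)) :=
    isPreconnected_connectedComponentIn.subset_closure (subset_insert _ _)
      (insert_subset hx.1 subset_closure)
  have hsub := hpre.subset_connectedComponentIn (mem_insert_of_mem x ha)
    (insert_subset hxE (connectedComponentIn_subset _ _))
  exact hx.2 (hsub (mem_insert _ _))

/-- If `z - a` has a continuous logarithm on the closed set `E`, then `a` does not lie in a bounded
component of the complement of `E`. -/
theorem not_isBounded_connectedComponentIn_compl {E : Set ℂ} (hE : IsClosed E) {a : ℂ}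
    (ha : a ∉ E) {h : ℂ → ℂ} (hc : ContinuousOn h E)
    (he : ∀ z ∈ E, Complex.exp (h z) = z - a) :
    ¬ Bornology.IsBounded (connectedComponentIn Eᶜ a) := by
  classical
  intro hb
  set Ω := connectedComponentIn Eᶜ a with hΩ
  have haΩ : a ∈ Ω := mem_connectedComponentIn ha
  obtain ⟨H, hH⟩ := ContinuousMap.exists_restrict_eq hE ⟨E.domRestrict h, hc.domRestrict⟩
  have hHE : ∀ z ∈ E, H z = h z := fun z hz => congrArg (fun u => u ⟨z, hz⟩) hH
  -- Tietze extension `H` of the logarithm removes the zero of `z - a` inside `Ω`. Then `G` has a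
  -- logarithm on the plane, which on a circle around `Ω` is a logarithm of `z - a`.
  set G : ℂ → ℂ := Ω.piecewise (fun z => Complex.exp (H z)) (fun z => z - a) with hG
  have hGc : Continuous G := by
    refine Continuous.piecewise (fun z hz => ?_) (by fun_prop) (by fun_prop)
    have hzE := frontier_connectedComponentIn_compl_subset hE a hz
    rw [hHE z hzE, he z hzE]
  have hG0 : ∀ z, G z ≠ 0 := fun z => by
    by_cases hz : z ∈ Ω
    · rw [hG, piecewise_eq_of_mem _ _ _ hz]
      exact Complex.exp_ne_zero _
    · rw [hG, piecewise_eq_of_notMem _ _ _ hz, sub_ne_zero]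
      rintro rfl
      exact hz haΩ
  obtain ⟨L, hLc, hL⟩ := exists_continuous_log hGc hG0
  obtain ⟨R, hR, hRΩ⟩ := hb.subset_ball_lt 0 a
  refine not_exists_continuous_log_circle a R ⟨L, hLc, fun θ => ?_⟩
  rw [hL, hG, piecewise_eq_of_notMem]
  intro hmem
  have := hRΩ hmem
  rw [mem_ball, dist_eq_norm, circleMap_sub_center, norm_circleMap_zero, abs_of_pos hR] at this
  exact lt_irrefl _ this

/-- The radial retraction of the plane onto a closed disc. -/
noncomputable def discRetract (c : ℂ) (r : ℝ) (z : ℂ) : ℂ :=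
  c + ((r / max r ‖z - c‖ : ℝ) : ℂ) * (z - c)

theorem continuous_discRetract (c : ℂ) {r : ℝ} (hr : 0 < r) : Continuous (discRetract c r) := by
  have h : Continuous fun z : ℂ => r / max r ‖z - c‖ :=
    continuous_const.div (by fun_prop) fun z => (lt_max_of_lt_left hr).ne'
  exact continuous_const.add ((Complex.continuous_ofReal.comp h).mul (by fun_prop))

theorem discRetract_mem (c : ℂ) {r : ℝ} (hr : 0 < r) (z : ℂ) :
    discRetract c r z ∈ closedBall c r := by
  have hm : 0 < max r ‖z - c‖ := lt_max_of_lt_left hr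
  rw [mem_closedBall, dist_eq_norm, discRetract, add_sub_cancel_left, norm_mul,
    Complex.norm_real, Real.norm_of_nonneg (by positivity), div_mul_eq_mul_div, div_le_iff₀ hm]
  gcongr
  exact le_max_right _ _

theorem discRetract_of_mem {c : ℂ} {r : ℝ} (hr : 0 < r) {z : ℂ} (hz : z ∈ closedBall c r) :
    discRetract c r z = z := by
  rw [mem_closedBall, dist_eq_norm] at hz
  rw [discRetract, max_eq_left hz, div_self hr.ne']
  simp

/-! ### Polynomial approximation on finite unions of disjoint univalent images of discs -/

theorem Submodule.intervalIntegral_mem {X : Type*} [NormedAddCommGroup X] [NormedSpace ℝ X]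
    [CompleteSpace X] (S : Submodule ℝ X) (hS : IsClosed (S : Set X)) {k : ℝ → X}
    (hk : Continuous k) (hkS : ∀ t, k t ∈ S) (a b : ℝ) : ∫ t in a..b, k t ∈ S := by
  have : CompleteSpace S := hS.completeSpace_coe
  have hc : Continuous fun t => (⟨k t, hkS t⟩ : S) := hk.subtype_mk hkS
  have h := S.subtypeL.intervalIntegral_comp_comm (hc.intervalIntegrable (μ := MeasureTheory.volume) a b)
  simp only [Submodule.subtypeL_apply] at h
  rw [h]
  exact Submodule.coe_mem _

/-- A family of univalent images of discs that are pairwise disjoint. -/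
structure UnivalentDiscs (ι : Type*) where
  /-- the univalent functions -/
  map : ι → ℂ → ℂ
  /-- the centres -/
  center : ι → ℂ
  /-- the inner radii -/
  inner : ι → ℝ
  /-- the outer radii -/
  outer : ι → ℝ
  inner_pos : ∀ i, 0 < inner i
  inner_lt_outer : ∀ i, inner i < outer i
  differentiableOn : ∀ i, DifferentiableOn ℂ (map i) (ball (center i) (outer i))
  injOn : ∀ i, InjOn (map i) (ball (center i) (outer i))
  disjoint : ∀ i j, i ≠ j → Disjoint (map i '' ball (center i) (outer i))
    (map j '' ball (center j) (outer j))

namespace UnivalentDiscs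

variable {ι : Type*} (D : UnivalentDiscs ι)

/-- The outer disc. -/
def disc (i : ι) : Set ℂ := ball (D.center i) (D.outer i)

/-- The inner closed disc. -/
def core (i : ι) : Set ℂ := closedBall (D.center i) (D.inner i)

/-- The union of the images of the inner closed discs. -/
def carrier : Set ℂ := ⋃ i, D.map i '' D.core i

theorem core_subset_disc (i : ι) : D.core i ⊆ D.disc i :=
  closedBall_subset_ball (D.inner_lt_outer i)

theorem isOpen_disc (i : ι) : IsOpen (D.disc i) := isOpen_ball

theorem isCompact_image_core (i : ι) : IsCompact (D.map i '' D.core i) :=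
  (isCompact_closedBall _ _).image_of_continuousOn
    ((D.differentiableOn i).continuousOn.mono (D.core_subset_disc i))

theorem isCompact_carrier [Finite ι] : IsCompact D.carrier :=
  isCompact_iUnion D.isCompact_image_core

instance [Finite ι] : CompactSpace D.carrier :=
  isCompact_iff_compactSpace.1 D.isCompact_carrier

theorem map_mem_carrier {i : ι} {z : ℂ} (hz : z ∈ D.core i) : D.map i z ∈ D.carrier :=
  mem_iUnion.2 ⟨i, z, hz, rfl⟩

theorem eq_of_mem_of_mem {i j : ι} {z : ℂ} (hi : z ∈ D.map i '' D.disc i)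
    (hj : z ∈ D.map j '' D.disc j) : i = j := by
  by_contra h
  exact disjoint_left.1 (D.disjoint i j h) hi hj

theorem exists_continuousOn_log [Finite ι] {a : ℂ} (ha : a ∉ D.carrier) :
    ∃ h : ℂ → ℂ, ContinuousOn h D.carrier ∧ ∀ z ∈ D.carrier, Complex.exp (h z) = z - a := by
  classical
  have hlog : ∀ i, ∃ h : ℂ → ℂ, Continuous h ∧
      ∀ z ∈ D.core i, Complex.exp (h z) = D.map i z - a := fun i => by
    -- Retracting onto the closed disc yields a zero-free function on the whole plane, where
    -- logarithms exist.
    have hP := continuous_discRetract (D.center i) (D.inner_pos i)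
    have hc : Continuous fun z => D.map i (discRetract (D.center i) (D.inner i) z) - a :=
      (((D.differentiableOn i).continuousOn.mono (D.core_subset_disc i)).comp_continuous hP
        (discRetract_mem _ (D.inner_pos i))).sub continuous_const
    obtain ⟨h, hh, he⟩ := exists_continuous_log hc fun z hz =>
      ha (sub_eq_zero.1 hz ▸ D.map_mem_carrier (discRetract_mem _ (D.inner_pos i) z))
    exact ⟨h, hh, fun z hz => by rw [he, discRetract_of_mem (D.inner_pos i) hz]⟩
  choose h hhc hhe using hlog
  set inv : ι → ℂ → ℂ := fun i => Function.invFunOn (D.map i) (D.disc i) with hinv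
  have hinvl : ∀ i, ∀ z ∈ D.core i, inv i (D.map i z) = z := fun i z hz =>
    (D.injOn i).leftInvOn_invFunOn (D.core_subset_disc i hz)
  set H : ℂ → ℂ := fun z =>
    if hz : ∃ i, z ∈ D.map i '' D.core i then h hz.choose (inv hz.choose z) else 0 with hH
  have hHe : ∀ i, EqOn H (fun z => h i (inv i z)) (D.map i '' D.core i) := fun i z hz => by
    have hex : ∃ i, z ∈ D.map i '' D.core i := ⟨i, hz⟩
    have hi : hex.choose = i := D.eq_of_mem_of_mem
      (image_mono (D.core_subset_disc _) hex.choose_spec)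
      (image_mono (D.core_subset_disc _) hz)
    simp only [hH, dif_pos hex, hi]
  refine ⟨H, ?_, ?_⟩
  · refine (locallyFinite_of_finite _).continuousOn_iUnion
      (fun i => (D.isCompact_image_core i).isClosed) fun i => ?_
    refine ContinuousOn.congr ?_ (hHe i)
    exact (hhc i).comp_continuousOn
      ((differentiableOn_invFunOn (D.isOpen_disc i) (D.differentiableOn i)
        (D.injOn i)).continuousOn.mono (image_mono (D.core_subset_disc i)))
  · intro z hz
    obtain ⟨i, w, hw, rfl⟩ := mem_iUnion.1 hz
    rw [hHe i ⟨w, hw, rfl⟩]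
    simp only [hinvl i w hw]
    exact hhe i w hw

/-- The uniform closure of the polynomials on the carrier. -/
noncomputable def polyClosure [Finite ι] : Subalgebra ℂ C(D.carrier, ℂ) :=
  (polynomialFunctions D.carrier).topologicalClosure

/-- Passing from `C(carrier)` to the closed subalgebra can only add to the spectrum of `X` points in
bounded components of the complement of the carrier. The logarithm criterion shows that `a` lies in
no such component. -/
theorem exists_resolvent_mem_polyClosure [Finite ι] {a : ℂ} (ha : a ∉ D.carrier) :
    ∃ y ∈ D.polyClosure, ∀ w : D.carrier, y w = (a - w)⁻¹ := by
  have hcl : IsClosed (D.polyClosure : Set C(D.carrier, ℂ)) :=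
    Subalgebra.isClosed_topologicalClosure _
  set X : C(D.carrier, ℂ) := Polynomial.toContinuousMapOnAlgHom D.carrier Polynomial.X with hX
  have hXv : ∀ w : D.carrier, X w = w := fun w => by simp [hX]
  have hXS : X ∈ D.polyClosure := Subalgebra.le_topologicalClosure _ ⟨Polynomial.X, trivial, rfl⟩
  have hspec : spectrum ℂ X = D.carrier := by
    rw [ContinuousMap.spectrum_eq_range]
    ext z
    simp [hXv]
  have hnot : a ∉ spectrum ℂ (⟨X, hXS⟩ : D.polyClosure) := by
    intro hmem
    have hb := Subalgebra.spectrum_isBounded_connectedComponentIn D.polyClosure ⟨X, hXS⟩ hmem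
    rw [hspec] at hb
    obtain ⟨h, hc, he⟩ := D.exists_continuousOn_log ha
    exact not_isBounded_connectedComponentIn_compl D.isCompact_carrier.isClosed ha hc he hb
  rw [spectrum.notMem_iff] at hnot
  obtain ⟨y, hy⟩ := hnot.exists_right_inv
  refine ⟨y, y.2, fun w => ?_⟩
  have h1 : (a - w) * (y : C(D.carrier, ℂ)) w = 1 := by
    have h2 := congrArg (fun u : D.polyClosure => (u : C(D.carrier, ℂ)) w) hy
    simpa [hXv] using h2
  exact eq_inv_of_mul_eq_one_right h1

/-- The function is `(2πi)⁻¹ ∮ G F' / (F - w) dζ` over a circle between the inner and outer ones.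
Taken as an integral in `C(carrier)` of multiples of resolvents, it stays in the closed subalgebra.
-/
theorem exists_mem_polyClosure_single [Finite ι] (i : ι) {G : ℂ → ℂ}
    (hG : DifferentiableOn ℂ G (D.disc i)) :
    ∃ y ∈ D.polyClosure, (∀ (w : D.carrier), ∀ z ∈ D.core i, D.map i z = w → y w = G z) ∧
      ∀ w : D.carrier, (∀ z ∈ D.disc i, D.map i z ≠ w) → y w = 0 := by
  have hcl : IsClosed (D.polyClosure : Set C(D.carrier, ℂ)) :=
    Subalgebra.isClosed_topologicalClosure _
  obtain ⟨s, hrs, hsR⟩ := exists_between (D.inner_lt_outer i)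
  set c := D.center i with hc
  set F := D.map i with hF
  have hs0 : 0 < s := (D.inner_pos i).trans hrs
  have hopen : IsOpen (D.disc i) := D.isOpen_disc i
  have hFd : DifferentiableOn ℂ F (D.disc i) := D.differentiableOn i
  have hFinj : InjOn F (D.disc i) := D.injOn i
  have hF'd : DifferentiableOn ℂ (deriv F) (D.disc i) := hFd.deriv hopen
  have hsub : closedBall c s ⊆ D.disc i := closedBall_subset_ball hsR
  have hcirc : ∀ θ, circleMap c s θ ∈ D.disc i := fun θ =>
    hsub (circleMap_mem_closedBall c hs0.le θ)
  have hoff : ∀ θ, F (circleMap c s θ) ∉ D.carrier := fun θ hmem => by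
    obtain ⟨j, z, hz, hzF⟩ := mem_iUnion.1 hmem
    have hji : j = i := D.eq_of_mem_of_mem ⟨z, D.core_subset_disc j hz, hzF⟩ ⟨_, hcirc θ, rfl⟩
    subst hji
    have := hFinj (D.core_subset_disc j hz) (hcirc θ) hzF
    rw [this, core, mem_closedBall, dist_eq_norm, circleMap_sub_center, norm_circleMap_zero,
      abs_of_pos hs0] at hz
    linarith
  set coef : ℝ → ℂ := fun θ => deriv (circleMap c s) θ *
    (G (circleMap c s θ) * deriv F (circleMap c s θ)) with hcoef
  have hcm := continuous_circleMap c s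
  have hcoefc : Continuous coef := by
    have h1 : Continuous (deriv (circleMap c s)) := by
      have : deriv (circleMap c s) = fun θ => circleMap 0 s θ * Complex.I := by
        ext θ; exact deriv_circleMap c s θ
      rw [this]
      fun_prop
    exact h1.mul ((hG.continuousOn.comp_continuous hcm hcirc).mul
      (hF'd.continuousOn.comp_continuous hcm hcirc))
  have hFc : Continuous fun θ => F (circleMap c s θ) :=
    hFd.continuousOn.comp_continuous hcm hcirc
  have hne : ∀ (θ : ℝ) (w : D.carrier), F (circleMap c s θ) - w ≠ 0 := fun θ w h =>
    hoff θ (sub_eq_zero.1 h ▸ w.2)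
  set K : C(ℝ × D.carrier, ℂ) :=
    ⟨fun p => coef p.1 * (F (circleMap c s p.1) - p.2)⁻¹,
      (hcoefc.comp continuous_fst).mul
        (((hFc.comp continuous_fst).sub (by fun_prop)).inv₀ fun p => hne p.1 p.2)⟩ with hK
  set k : ℝ → C(D.carrier, ℂ) := fun θ => K.curry θ with hk
  have hkc : Continuous k := K.curry.continuous
  have hkS : ∀ θ, k θ ∈ D.polyClosure := fun θ => by
    obtain ⟨y, hy, hyv⟩ := D.exists_resolvent_mem_polyClosure (hoff θ)
    have : k θ = coef θ • y := by
      ext w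
      simp [hk, hK, hyv]
    rw [this]
    exact D.polyClosure.smul_mem hy _
  set I : C(D.carrier, ℂ) := ∫ θ in (0 : ℝ)..2 * Real.pi, k θ with hI
  have hIS : I ∈ D.polyClosure :=
    Submodule.intervalIntegral_mem ((Subalgebra.toSubmodule D.polyClosure).restrictScalars ℝ)
      hcl hkc hkS _ _
  have hIv : ∀ w : D.carrier, I w = circleIntegral
      (fun ζ => G ζ * deriv F ζ * (F ζ - w)⁻¹) c s := fun w => by
    have h1 := (ContinuousMap.evalCLM ℂ w).intervalIntegral_comp_comm
      (hkc.intervalIntegrable (μ := MeasureTheory.volume) 0 (2 * Real.pi))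
    have h2 : I w = ∫ θ in (0 : ℝ)..2 * Real.pi, k θ w := h1.symm
    rw [h2, circleIntegral]
    refine intervalIntegral.integral_congr fun θ _ => ?_
    simp [hk, hK, hcoef, mul_assoc]
  refine ⟨(2 * Real.pi * Complex.I : ℂ)⁻¹ • I, D.polyClosure.smul_mem hIS _, ?_, ?_⟩
  · intro w z hz hzw
    have hzd : z ∈ D.disc i := D.core_subset_disc i hz
    -- Writing `F ζ - F z = (ζ - z) * dslope F z ζ`, with zero-free second factor by injectivity,
    -- reduces the integral to Cauchy's formula with value `G z * F' z / F' z`.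
    have hdd : DifferentiableOn ℂ (dslope F z) (D.disc i) :=
      (Complex.differentiableOn_dslope (hopen.mem_nhds hzd)).2 hFd
    have hd0 : ∀ ζ ∈ D.disc i, dslope F z ζ ≠ 0 := fun ζ hζ => by
      rcases eq_or_ne ζ z with rfl | hζz
      · rw [dslope_same]
        exact deriv_ne_zero_of_injOn hopen hFd hFinj hζ
      · intro h
        have h1 := sub_smul_dslope F z ζ
        rw [h, smul_zero] at h1
        exact hζz (hFinj hζ hzd (sub_eq_zero.1 h1.symm))
    have hq : DifferentiableOn ℂ (fun ζ => G ζ * deriv F ζ / dslope F z ζ) (D.disc i) :=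
      (hG.mul hF'd).div hdd hd0
    have hzs : z ∈ ball c s := closedBall_subset_ball hrs hz
    have hcauchy := (DifferentiableOn.diffContOnCl_ball hq hsub).circleIntegral_sub_inv_smul hzs
    have hcongr : circleIntegral (fun ζ => G ζ * deriv F ζ * (F ζ - w)⁻¹) c s =
        circleIntegral (fun ζ => (ζ - z)⁻¹ • (G ζ * deriv F ζ / dslope F z ζ)) c s := by
      refine circleIntegral.integral_congr hs0.le fun ζ _ => ?_
      have h1 := sub_smul_dslope F z ζ
      rw [hzw] at h1
      simp only [smul_eq_mul] at h1 ⊢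
      rw [← h1, mul_inv]
      ring
    rw [ContinuousMap.smul_apply, hIv, hcongr, hcauchy, smul_smul,
      inv_mul_cancel₀ Complex.two_pi_I_ne_zero, one_smul, dslope_same,
      mul_div_cancel_right₀ _ (deriv_ne_zero_of_injOn hopen hFd hFinj hzd)]
  · intro w hw
    have hq : DifferentiableOn ℂ (fun ζ => G ζ * deriv F ζ * (F ζ - w)⁻¹) (D.disc i) :=
      (hG.mul hF'd).mul ((hFd.sub_const _).inv fun ζ hζ => sub_ne_zero.2 (hw ζ hζ))
    rw [ContinuousMap.smul_apply, hIv,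
      (DifferentiableOn.diffContOnCl_ball hq hsub).circleIntegral_eq_zero hs0.le, smul_zero]

/-- **Runge approximation** on a finite disjoint union of univalent images of closed discs. -/
theorem exists_polynomial_approx [Fintype ι] {G : ι → ℂ → ℂ}
    (hG : ∀ i, DifferentiableOn ℂ (G i) (D.disc i)) {ε : ℝ} (hε : 0 < ε) :
    ∃ p : Polynomial ℂ, ∀ i, ∀ z ∈ D.core i, ‖p.eval (D.map i z) - G i z‖ < ε := by
  choose y hyS hy1 hy0 using fun i => D.exists_mem_polyClosure_single i (hG i)
  have hsum : ∑ i, y i ∈ D.polyClosure := sum_mem fun i _ => hyS i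
  have hcl : (∑ i, y i) ∈ closure (polynomialFunctions D.carrier : Set C(D.carrier, ℂ)) := by
    rw [← Subalgebra.topologicalClosure_coe]
    exact hsum
  obtain ⟨_, ⟨p, -, rfl⟩, hp⟩ := Metric.mem_closure_iff.1 hcl ε hε
  refine ⟨p, fun i z hz => ?_⟩
  set w : D.carrier := ⟨D.map i z, D.map_mem_carrier hz⟩ with hw
  have hval : (∑ j, y j) w = G i z := by
    rw [ContinuousMap.sum_apply, Finset.sum_eq_single i]
    · exact hy1 i w z hz rfl
    · intro j _ hji
      refine hy0 j w fun x hx hxw => hji ?_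
      exact D.eq_of_mem_of_mem ⟨x, hx, hxw⟩ ⟨z, D.core_subset_disc i hz, rfl⟩
    · simp
  have := (ContinuousMap.dist_apply_le_dist w).trans_lt hp
  rw [hval, dist_comm, dist_eq_norm] at this
  simpa [hw] using this

end UnivalentDiscs

/-! ### Universality -/

theorem exists_isCompact_of_mem_nhds {X : Type*} [TopologicalSpace X] {h : C(X, ℂ)}
    {B : Set C(X, ℂ)} (hB : B ∈ 𝓝 h) :
    ∃ K : Set X, IsCompact K ∧ ∃ ε > 0, ∀ u : C(X, ℂ), (∀ x ∈ K, dist (h x) (u x) < ε) → u ∈ B := by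
  have hb := (Metric.uniformity_basis_dist (α := ℂ)).compactConvergenceUniformity (α := X)
  obtain ⟨⟨K, ε⟩, ⟨hK, hε⟩, hsub⟩ := (nhds_basis_uniformity' hb).mem_iff.1 hB
  exact ⟨K, hK, ε, hε, fun u hu => hsub fun x hx => hu x hx⟩

/-- Only a subsequence escapes, but a whole block of iterates ending at `s k` is large: a point in
the `R`-disc at time `s k - j`, `j ≤ M`, would be at time `s k` within the maximum of `‖f^[j]‖` on
that disc. -/
theorem InftyIsLimitFunction.exists_forall_lt_norm {f : ℂ → ℂ} (hf : Continuous f) {U : Set ℂ}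
    (h : InftyIsLimitFunction f U) {K : Set ℂ} (hKU : K ⊆ U) (hK : IsCompact K) (R : ℝ) (M : ℕ) :
    ∃ n, ∀ m ≤ M, ∀ z ∈ K, R < ‖f^[n + m] z‖ := by
  obtain ⟨s, hs, hlim⟩ := h
  have hbd : ∀ j, ∃ C, ∀ w ∈ closedBall (0 : ℂ) R, ‖f^[j] w‖ ≤ C := fun j =>
    (isCompact_closedBall (0 : ℂ) R).exists_bound_of_continuousOn (hf.iterate j).continuousOn
  choose C hC using hbd
  obtain ⟨C', hC'⟩ := ((Finset.range (M + 1)).image C).exists_le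
  obtain ⟨k, hk, hsk⟩ := ((hlim K hKU hK C').and (hs.tendsto_atTop.eventually_ge_atTop M)).exists
  refine ⟨s k - M, fun m hm z hz => ?_⟩
  by_contra! hle
  have h1 := hC (M - m) _ (mem_closedBall_zero_iff.2 hle)
  rw [← Function.iterate_add_apply, show M - m + (s k - M + m) = s k by omega] at h1
  have h2 := hC' _ (Finset.mem_image_of_mem C (Finset.mem_range.2 (by omega : M - m < M + 1)))
  linarith [hk z hz]

/-- One index `k` bounds both the iterate and the radius, giving an increasing open exhaustion of
the union to which compactness applies. -/
theorem exists_image_ball_cover {f : ℂ → ℂ} (hf : Differentiable ℂ f) {z₀ : ℂ} {r : ℝ}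
    (hr : 0 < r) (hinj : ∀ n, InjOn f^[n] (ball z₀ r)) {K : Set ℂ} (hK : IsCompact K)
    (hKV : K ⊆ ⋃ n : ℕ, f^[n] '' ball z₀ r) :
    ∃ M : ℕ, ∃ r₁, 0 < r₁ ∧ r₁ < r ∧ ∀ w ∈ K, ∃ m ≤ M, ∃ z ∈ closedBall z₀ r₁, f^[m] z = w := by
  set ρ : ℕ → ℝ := fun k => r * (1 - 1 / (k + 2)) with hρ
  have hρ0 : ∀ k, 0 < ρ k := fun k => by
    have : (1 : ℝ) / (k + 2) < 1 := by
      rw [div_lt_one (by positivity)]; linarith [(Nat.cast_nonneg k : (0 : ℝ) ≤ k)]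
    exact mul_pos hr (by linarith)
  have hρr : ∀ k, ρ k < r := fun k => by
    have : (0 : ℝ) < 1 / (k + 2) := by positivity
    exact mul_lt_of_lt_one_right hr (by linarith)
  have hρm : Monotone ρ := fun a b hab => by
    have : (a : ℝ) ≤ b := by exact_mod_cast hab
    simp only [hρ]
    gcongr
  have hρl : Tendsto ρ atTop (𝓝 r) := by
    have h1 : Tendsto (fun k : ℕ => (1 : ℝ) / (k + 2)) atTop (𝓝 0) := by
      have := (tendsto_add_atTop_iff_nat 1).2 (tendsto_one_div_add_atTop_nhds_zero_nat (𝕜 := ℝ))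
      refine this.congr fun k => ?_
      push_cast
      ring
    simpa [hρ] using (h1.const_sub 1).const_mul r
  set W : ℕ → Set ℂ := fun k => ⋃ m ∈ Iic k, f^[m] '' ball z₀ (ρ k) with hW
  have hWo : ∀ k, IsOpen (W k) := fun k => isOpen_biUnion fun m _ =>
    isOpen_image_of_injOn isOpen_ball (hf.iterate m).differentiableOn
      ((hinj m).mono (ball_subset_ball (hρr k).le))
  have hWm : Monotone W := fun a b hab =>
    biUnion_mono (Iic_subset_Iic.2 hab) fun m _ => image_mono (ball_subset_ball (hρm hab))
  have hKW : K ⊆ ⋃ k, W k := fun w hw => by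
    obtain ⟨m, z, hz, rfl⟩ := mem_iUnion.1 (hKV hw)
    obtain ⟨k, hk, hmk⟩ := ((hρl.eventually_const_lt (mem_ball.1 hz)).and
      (eventually_ge_atTop m)).exists
    exact mem_iUnion.2 ⟨k, mem_biUnion hmk ⟨z, hk, rfl⟩⟩
  obtain ⟨k, hk⟩ := hK.elim_directed_cover W hWo hKW hWm.directed_le
  refine ⟨k, ρ k, hρ0 k, hρr k, fun w hw => ?_⟩
  obtain ⟨m, hm, z, hz, rfl⟩ := mem_iUnion₂.1 (hk hw)
  exact ⟨m, hm, z, ball_subset_closedBall hz, rfl⟩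

/-- Simultaneous approximation by an entire function: close to a given entire function on a disc,
with a composition with some iterate close to a given holomorphic function on a compact set. -/
theorem exists_polynomial_simultaneous_approx {f : ℂ → ℂ} (hf : Differentiable ℂ f) {U : Set ℂ}
    (hU : ∀ m n : ℕ, m ≠ n → Disjoint (f^[m] '' U) (f^[n] '' U))
    (hinf : InftyIsLimitFunction f U) {z₀ : ℂ} {r : ℝ} (hr : 0 < r) (hball : ball z₀ r ⊆ U)
    (hinj : ∀ n, InjOn f^[n] (ball z₀ r)) {g H : ℂ → ℂ} (hg : Differentiable ℂ g)
    (hH : DifferentiableOn ℂ H (⋃ n : ℕ, f^[n] '' ball z₀ r)) {K : Set ℂ} (hK : IsCompact K)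
    (hKV : K ⊆ ⋃ n : ℕ, f^[n] '' ball z₀ r) (R : ℝ) {ε : ℝ} (hε : 0 < ε) :
    ∃ (p : Polynomial ℂ) (n : ℕ), (∀ z ∈ closedBall (0 : ℂ) R, ‖p.eval z‖ < ε) ∧
      ∀ w ∈ K, ‖g (f^[n] w) + p.eval (f^[n] w) - H w‖ < ε := by
  obtain ⟨M, r₁, hr₁0, hr₁, hcov⟩ := exists_image_ball_cover hf hr hinj hK hKV
  obtain ⟨r₂, hr₁₂, hr₂⟩ := exists_between hr₁
  set R' := max R 1 with hR'
  have hR'0 : 0 < R' := lt_max_of_lt_right one_pos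
  obtain ⟨n, hn⟩ := hinf.exists_forall_lt_norm hf.continuous
    ((closedBall_subset_ball hr₂).trans hball) (isCompact_closedBall z₀ r₂) (R' + 1) M
  have hsub : ball z₀ r₂ ⊆ ball z₀ r := ball_subset_ball hr₂.le
  have hfar : ∀ m : Fin (M + 1), Disjoint (id '' ball (0 : ℂ) (R' + 1))
      (f^[n + m] '' ball z₀ r₂) := fun m => by
    rw [image_id, disjoint_right]
    rintro _ ⟨z, hz, rfl⟩ hmem
    have := hn m (Nat.lt_succ_iff.1 m.2) z (ball_subset_closedBall hz)
    rw [mem_ball_zero_iff] at hmem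
    linarith
  let D : UnivalentDiscs (Option (Fin (M + 1))) :=
    { map := fun i => i.elim id fun m => f^[n + m]
      center := fun i => i.elim 0 fun _ => z₀
      inner := fun i => i.elim R' fun _ => r₁
      outer := fun i => i.elim (R' + 1) fun _ => r₂
      inner_pos := by
        rintro (_ | m)
        · exact hR'0
        · exact hr₁0
      inner_lt_outer := by
        rintro (_ | m)
        · exact lt_add_one R'
        · exact hr₁₂
      differentiableOn := by
        rintro (_ | m)
        · exact differentiableOn_id
        · exact (hf.iterate _).differentiableOn
      injOn := by
        rintro (_ | m)
        · exact injOn_id _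
        · exact (hinj _).mono hsub
      disjoint := by
        rintro (_ | m) (_ | m') hne
        · exact absurd rfl hne
        · exact hfar m'
        · exact (hfar m).symm
        · refine (hU (n + m) (n + m') fun h => hne ?_).mono (image_mono (hsub.trans hball))
            (image_mono (hsub.trans hball))
          rw [Fin.ext (Nat.add_left_cancel h)] }
  -- In the parameter `z`, with `w = f^[m] z` and `f^[n] w = f^[n + m] z`, the correction to add to
  -- `g` is `H w - g (f^[n] w)`; on the central disc it is `0`.
  obtain ⟨p, hp⟩ := D.exists_polynomial_approx
    (G := fun i => i.elim (fun _ => 0) fun m z => H (f^[m] z) - g (f^[n + m] z)) (by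
      rintro (_ | m)
      · exact differentiableOn_const 0
      · refine DifferentiableOn.sub ?_ (hg.comp (hf.iterate _)).differentiableOn
        exact hH.comp (hf.iterate _).differentiableOn fun z hz =>
          mem_iUnion.2 ⟨m, z, hsub hz, rfl⟩) hε
  refine ⟨p, n, fun z hz => ?_, fun w hw => ?_⟩
  · have := hp none z (closedBall_subset_closedBall (le_max_left _ _) hz)
    simpa [D] using this
  · obtain ⟨m, hm, z, hz, rfl⟩ := hcov w hw
    have h1 := hp (some ⟨m, Nat.lt_succ_iff.2 hm⟩) z hz
    have h2 : f^[n] (f^[m] z) = f^[n + m] z := (Function.iterate_add_apply f n m z).symm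
    rw [h2]
    convert h1 using 2
    simp only [D, Option.elim]
    ring

/-- The map `g ↦ g ∘ f^n|_V`. -/
noncomputable def compIterate {f : ℂ → ℂ} (hf : Continuous f) (V : Set ℂ) (n : ℕ) (g : EntireFunction) :
    C(V, ℂ) :=
  g.1.comp ⟨fun z : V => f^[n] z, (hf.iterate n).comp continuous_subtype_val⟩

theorem continuous_compIterate {f : ℂ → ℂ} (hf : Continuous f) (V : Set ℂ) (n : ℕ) :
    Continuous (compIterate hf V n) :=
  (ContinuousMap.continuous_precomp _).comp continuous_subtype_val

theorem residual_isUniversalOn {f : ℂ → ℂ} (hf : Differentiable ℂ f) {U : Set ℂ}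
    (hU : ∀ m n : ℕ, m ≠ n → Disjoint (f^[m] '' U) (f^[n] '' U))
    (hinf : InftyIsLimitFunction f U) {z₀ : ℂ} {r : ℝ} (hr : 0 < r) (hball : ball z₀ r ⊆ U)
    (hinj : ∀ n, InjOn f^[n] (ball z₀ r)) :
    {g : EntireFunction | IsUniversalOn f (⋃ n : ℕ, f^[n] '' ball z₀ r) g.1} ∈
      residual EntireFunction := by
  set V := ⋃ n : ℕ, f^[n] '' ball z₀ r with hV
  have hVo : IsOpen V := isOpen_iUnion fun n =>
    isOpen_image_of_injOn isOpen_ball (hf.iterate n).differentiableOn (hinj n)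
  have : LocallyCompactSpace V := hVo.locallyCompactSpace
  set S : Set C(V, ℂ) := {h | ∃ H : ℂ → ℂ, DifferentiableOn ℂ H V ∧ ∀ z : V, h z = H z} with hS
  -- Only holomorphic targets must be approximated, so basic open sets missing `S` are discarded;
  -- countability comes from second countability of `C(V, ℂ)`, `V` being locally compact.
  set 𝓑 : Set (Set C(V, ℂ)) :=
    {B ∈ TopologicalSpace.countableBasis C(V, ℂ) | (B ∩ S).Nonempty} with h𝓑
  have hcount : 𝓑.Countable :=
    (TopologicalSpace.countable_countableBasis C(V, ℂ)).mono fun _ h => h.1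
  have hres : ∀ B ∈ 𝓑, (⋃ n, compIterate hf.continuous V n ⁻¹' B) ∈ residual EntireFunction := by
    rintro B ⟨hB, h, hhB, H, hHd, hhH⟩
    have hBo : IsOpen B := TopologicalSpace.isOpen_of_mem_countableBasis hB
    refine residual_of_dense_open
      (isOpen_iUnion fun n => hBo.preimage (continuous_compIterate _ V n)) ?_
    rw [dense_iff_inter_open]
    rintro O hO ⟨g, hgO⟩
    obtain ⟨O', hO', rfl⟩ := isOpen_induced_iff.1 hO
    obtain ⟨K₁, hK₁, ε₁, hε₁, h₁⟩ := exists_isCompact_of_mem_nhds (hO'.mem_nhds hgO)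
    obtain ⟨K₂, hK₂, ε₂, hε₂, h₂⟩ := exists_isCompact_of_mem_nhds (hBo.mem_nhds hhB)
    obtain ⟨R, hR⟩ := hK₁.isBounded.subset_closedBall 0
    obtain ⟨p, n, hp, hpH⟩ := exists_polynomial_simultaneous_approx hf hU hinf hr hball hinj
      g.2 hHd (hK₂.image continuous_subtype_val) (by rintro _ ⟨w, -, rfl⟩; exact w.2) R
      (lt_min hε₁ hε₂)
    let G : EntireFunction := ⟨⟨fun z => g.1 z + p.eval z, by fun_prop⟩,
      g.2.add p.differentiable⟩
    refine ⟨G, h₁ _ fun z hz => ?_, mem_iUnion.2 ⟨n, h₂ _ fun w hw => ?_⟩⟩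
    · have := (hp z (hR hz)).trans_le (min_le_left _ _)
      rw [dist_eq_norm', show (G : EntireFunction).1 z - g.1 z = p.eval z from
        add_sub_cancel_left _ _]
      exact this
    · rw [dist_eq_norm', hhH]
      exact (hpH w ⟨w, hw, rfl⟩).trans_le (min_le_right _ _)
  refine mem_of_superset ((countable_bInter_mem hcount).2 hres) fun g hg h hh => ?_
  rw [(TopologicalSpace.isBasis_countableBasis C(V, ℂ)).mem_closure_iff]
  intro B hB hhB
  obtain ⟨n, hn⟩ := mem_iUnion.1 (mem_iInter₂.1 hg B ⟨hB, h, hhB, hh⟩)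
  exact ⟨_, hn, n, fun z => rfl⟩

end WanderingUniversality

theorem mainTheorem4 (f : ℂ → ℂ) (hf : WanderingUniversality.IsTranscendentalEntire f)
    (U : ℕ → Set ℂ) (hU : WanderingUniversality.IsWanderingSequence f U)
    (hsemi : WanderingUniversality.IsSemiContracting f U)
    (hdeg : ∀ n, WanderingUniversality.HasDegree f (U n) (U (n + 1)) 2) :
    ∃ V₀ : Set ℂ, IsOpen V₀ ∧ V₀.Nonempty ∧ V₀ ⊆ U 0 ∧
      (∀ n : ℕ, Set.InjOn f^[n] V₀) ∧
      (WanderingUniversality.IsEscaping f (U 0) ∨ WanderingUniversality.IsOscillating f (U 0) →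
        {g : WanderingUniversality.EntireFunction |
          WanderingUniversality.IsUniversalOn f (⋃ n : ℕ, f^[n] '' V₀) g.1} ∈
            residual WanderingUniversality.EntireFunction) := by
  obtain ⟨z₀, r, hr, hball, hinj⟩ :=
    WanderingUniversality.exists_ball_forall_injOn_iterate hf hU hsemi fun n => (hdeg n).1
  refine ⟨Metric.ball z₀ r, Metric.isOpen_ball, Metric.nonempty_ball.2 hr, hball, hinj,
    fun hlim => ?_⟩
  -- Both cases enter only through infinity being a limit function.
  exact WanderingUniversality.residual_isUniversalOn hf.1 hU.1.2
    (hlim.elim (fun h => h.1) fun h => h.1) hr hball hinj
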